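/- Let $\delta\in\mathbb C$. A $\delta$-Poisson algebra is a complex vector space with a commutative associative product $x\cdot y$ and a Lie bracket $\{x,y\}$ such that $$\{x\cdot y,z\}=\delta\big(x\cdot\{y,z\}+\{x,z\}\cdot y\big)\qquad\text{for all }x,y,z .$$ Let $\delta\text{-}\mathrm P$ be the symmetric operad over $\mathbb C$ governing $\delta$-Poisson algebras, that is, the binary quadratic operad $F(E)/(R)$, where $E$ is the $\mathbb S_2$-module spanned by a symmetric operation $x_1\cdot x_2$ and an antisymmetric operation $\{x_1,x_2\}$, $F(E)$ is the free operad on $E$, and $R\subset F(E)(3)$ is the $\mathbb S_3$-submodule generated by associativity of $\cdot$, the Jacobi identity for $\{\cdot,\cdot\}$ and the displayed identity. For a binary quadratic operad $\mathcal P=F(E)/(R)$ with $\dim E<\infty$, its Koszul dual (Ginzburg--Kapranov) is $\mathcal P^!=F(E^\vee)/(R^\perp)$, where $E^\vee=E^*\otimes\mathrm{sgn}$ and $R^\perp\subset F(E^\vee)(3)\cong F(E)(3)^*\otimes\mathrm{sgn}$ is the annihilator of $R$. Here $F(E)(3)$ is identified with the direct sum of three copies of $E\otimes E$: the element $\mu\otimes\nu$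 of the $i$-th copy ($i\in\mathbb Z/3$) is the operation $\mu(\nu(x_{i+1},x_{i+2}),x_i)$; likewise for $E^\vee$, and the pairing is the sum over the three copies of the evaluation pairings of $E^*\otimes E^*$ with $E\otimes E$. Then, for every $\delta\in\mathbb C$, the operad $\delta\text{-}\mathrm P$ is self-dual: there is an isomorphism of symmetric operads $$(\delta\text{-}\mathrm P)^!\;\cong\;\delta\text{-}\mathrm P .$$ -/

import Mathlib

open scoped TensorProduct

universe u v w

/-- A `k`-linear symmetric operad, in its coordinate-free form: the components are indexed by finite
sets (the usual `n`-th component with its action of the symmetric group is `obj (Fin n)` with `map`),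
and `comp p q` plugs, for every input `a` of `p`, the operation `q a` into `a`. -/
structure SymmOperad (k : Type u) [Field k] where
  /-- the component of operations whose inputs are labelled by `A` -/
  obj : (A : Type) → [Finite A] → Type v
  [addCommGroup : ∀ (A : Type) [Finite A], AddCommGroup (obj A)]
  [module : ∀ (A : Type) [Finite A], Module k (obj A)]
  /-- relabelling of the inputs -/
  map : ∀ {A B : Type} [Finite A] [Finite B], (A ≃ B) → obj A →ₗ[k] obj B
  /-- the identity operation -/
  one : obj Unit
  /-- simultaneous composition -/
  comp : ∀ {A : Type} {B : A → Type} [Finite A] [∀ a, Finite (B a)],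
    obj A →ₗ[k] MultilinearMap k (fun a => obj (B a)) (obj (Σ a, B a))
  map_refl : ∀ {A : Type} [Finite A] (p : obj A), map (Equiv.refl A) p = p
  map_trans : ∀ {A B C : Type} [Finite A] [Finite B] [Finite C] (e : A ≃ B) (f : B ≃ C) (p : obj A),
    map (e.trans f) p = map f (map e p)
  comp_map_left : ∀ {A A' : Type} {B : A' → Type} [Finite A] [Finite A'] [∀ a, Finite (B a)]
    (e : A ≃ A') (p : obj A) (q : ∀ a, obj (B a)),
    comp (map e p) q = map (Equiv.sigmaCongrLeft e) (comp p fun a => q (e a))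
  comp_map_right : ∀ {A : Type} {B B' : A → Type} [Finite A] [∀ a, Finite (B a)]
    [∀ a, Finite (B' a)] (f : ∀ a, B a ≃ B' a) (p : obj A) (q : ∀ a, obj (B a)),
    comp p (fun a => map (f a) (q a)) = map (Equiv.sigmaCongrRight f) (comp p q)
  one_comp : ∀ {B : Type} [Finite B] (q : obj B),
    map (Equiv.uniqueSigma fun _ : Unit => B) (comp one fun _ => q) = q
  comp_one : ∀ {A : Type} [Finite A] (p : obj A),
    map (Equiv.sigmaPUnit A) (comp p fun _ => one) = p
  comp_assoc : ∀ {A : Type} {B : A → Type} {C : ∀ a, B a → Type} [Finite A] [∀ a, Finite (B a)]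
    [∀ a b, Finite (C a b)] (p : obj A) (q : ∀ a, obj (B a)) (r : ∀ a b, obj (C a b)),
    map (Equiv.sigmaAssoc C) (comp (comp p q) fun x => r x.1 x.2) =
      comp p fun a => comp (q a) (r a)

attribute [instance] SymmOperad.addCommGroup SymmOperad.module

/-- Isomorphisms of operads. -/
structure SymmOperad.Iso {k : Type u} [Field k] (P : SymmOperad.{u, v} k)
    (Q : SymmOperad.{u, w} k) where
  equiv : ∀ (A : Type) [Finite A], P.obj A ≃ₗ[k] Q.obj A
  equiv_map : ∀ {A B : Type} [Finite A] [Finite B] (e : A ≃ B) (p : P.obj A),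
    equiv B (P.map e p) = Q.map e (equiv A p)
  equiv_one : equiv Unit P.one = Q.one
  equiv_comp : ∀ {A : Type} {B : A → Type} [Finite A] [∀ a, Finite (B a)]
    (p : P.obj A) (q : ∀ a, P.obj (B a)),
    equiv (Σ a, B a) (P.comp p q) = Q.comp (equiv A p) fun a => equiv (B a) (q a)

/-! ### Operads given by binary generators and relations -/

/-- Formal operadic expressions in binary operations taken from `E`. -/
inductive OpTerm (k : Type u) (E : Type u) : Type → Type (max 1 u)
  | gen (e : E) : OpTerm k E (Fin 2)
  | one : OpTerm k E Unit
  | zero {A : Type} : OpTerm k E A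
  | add {A : Type} (s t : OpTerm k E A) : OpTerm k E A
  | smul {A : Type} (c : k) (t : OpTerm k E A) : OpTerm k E A
  | map {A B : Type} (e : A ≃ B) (t : OpTerm k E A) : OpTerm k E B
  | comp {A : Type} {B : A → Type} [Finite A] [∀ a, Finite (B a)]
      (t : OpTerm k E A) (s : ∀ a, OpTerm k E (B a)) : OpTerm k E (Σ a, B a)

section Presentation

variable {k : Type u} [Field k] {E : Type u} [AddCommGroup E] [Module k E]

/-- The congruence on operadic expressions generated by the axioms of a `k`-linear operad, by the
linear structure and the action of `𝕊₂` on the generators, and by `t = 0` for all `t` in `S`. -/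
inductive OpRel (ρ : Representation k (Equiv.Perm (Fin 2)) E) (S : ∀ A : Type, Set (OpTerm k E A)) :
    ∀ {A : Type}, OpTerm k E A → OpTerm k E A → Prop
  -- relations imposed by hand
  | of {A : Type} (t : OpTerm k E A) (h : t ∈ S A) : OpRel ρ S t .zero
  -- equivalence relation
  | refl {A : Type} (t : OpTerm k E A) : OpRel ρ S t t
  | symm {A : Type} {s t : OpTerm k E A} : OpRel ρ S s t → OpRel ρ S t s
  | trans {A : Type} {s t r : OpTerm k E A} : OpRel ρ S s t → OpRel ρ S t r → OpRel ρ S s r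
  -- congruence
  | add_congr {A : Type} {s s' t t' : OpTerm k E A} :
      OpRel ρ S s s' → OpRel ρ S t t' → OpRel ρ S (.add s t) (.add s' t')
  | smul_congr {A : Type} (c : k) {t t' : OpTerm k E A} :
      OpRel ρ S t t' → OpRel ρ S (.smul c t) (.smul c t')
  | map_congr {A B : Type} (e : A ≃ B) {t t' : OpTerm k E A} :
      OpRel ρ S t t' → OpRel ρ S (.map e t) (.map e t')
  | comp_congr {A : Type} {B : A → Type} [Finite A] [∀ a, Finite (B a)] {t t' : OpTerm k E A}
      {s s' : ∀ a, OpTerm k E (B a)} : OpRel ρ S t t' → (∀ a, OpRel ρ S (s a) (s' a)) →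
      OpRel ρ S (.comp t s) (.comp t' s')
  -- vector space axioms
  | add_assoc {A : Type} (s t r : OpTerm k E A) :
      OpRel ρ S (.add (.add s t) r) (.add s (.add t r))
  | add_comm {A : Type} (s t : OpTerm k E A) : OpRel ρ S (.add s t) (.add t s)
  | zero_add {A : Type} (t : OpTerm k E A) : OpRel ρ S (.add .zero t) t
  | neg_add {A : Type} (t : OpTerm k E A) : OpRel ρ S (.add (.smul (-1) t) t) .zero
  | one_smul {A : Type} (t : OpTerm k E A) : OpRel ρ S (.smul 1 t) t
  | mul_smul {A : Type} (c d : k) (t : OpTerm k E A) :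
      OpRel ρ S (.smul (c * d) t) (.smul c (.smul d t))
  | smul_add {A : Type} (c : k) (s t : OpTerm k E A) :
      OpRel ρ S (.smul c (.add s t)) (.add (.smul c s) (.smul c t))
  | add_smul {A : Type} (c d : k) (t : OpTerm k E A) :
      OpRel ρ S (.smul (c + d) t) (.add (.smul c t) (.smul d t))
  -- linearity of the relabelling and of the composition
  | map_add {A B : Type} (e : A ≃ B) (s t : OpTerm k E A) :
      OpRel ρ S (.map e (.add s t)) (.add (.map e s) (.map e t))
  | map_smul {A B : Type} (e : A ≃ B) (c : k) (t : OpTerm k E A) :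
      OpRel ρ S (.map e (.smul c t)) (.smul c (.map e t))
  | add_comp {A : Type} {B : A → Type} [Finite A] [∀ a, Finite (B a)] (t t' : OpTerm k E A)
      (s : ∀ a, OpTerm k E (B a)) :
      OpRel ρ S (.comp (.add t t') s) (.add (.comp t s) (.comp t' s))
  | smul_comp {A : Type} {B : A → Type} [Finite A] [∀ a, Finite (B a)] (c : k) (t : OpTerm k E A)
      (s : ∀ a, OpTerm k E (B a)) :
      OpRel ρ S (.comp (.smul c t) s) (.smul c (.comp t s))
  | comp_add {A : Type} [DecidableEq A] {B : A → Type} [Finite A] [∀ a, Finite (B a)]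
      (t : OpTerm k E A) (s : ∀ a, OpTerm k E (B a)) (a : A) (x y : OpTerm k E (B a)) :
      OpRel ρ S (.comp t (Function.update s a (.add x y)))
        (.add (.comp t (Function.update s a x)) (.comp t (Function.update s a y)))
  | comp_smul {A : Type} [DecidableEq A] {B : A → Type} [Finite A] [∀ a, Finite (B a)]
      (t : OpTerm k E A) (s : ∀ a, OpTerm k E (B a)) (a : A) (c : k) (x : OpTerm k E (B a)) :
      OpRel ρ S (.comp t (Function.update s a (.smul c x)))
        (.smul c (.comp t (Function.update s a x)))
  -- operad axioms
  | map_refl {A : Type} (t : OpTerm k E A) : OpRel ρ S (.map (Equiv.refl A) t) t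
  | map_trans {A B C : Type} (e : A ≃ B) (f : B ≃ C) (t : OpTerm k E A) :
      OpRel ρ S (.map (e.trans f) t) (.map f (.map e t))
  | comp_map_left {A A' : Type} {B : A' → Type} [Finite A] [Finite A'] [∀ a, Finite (B a)]
      (e : A ≃ A') (t : OpTerm k E A) (s : ∀ a, OpTerm k E (B a)) :
      OpRel ρ S (.comp (.map e t) s)
        (.map (Equiv.sigmaCongrLeft e) (.comp t fun a => s (e a)))
  | comp_map_right {A : Type} {B B' : A → Type} [Finite A] [∀ a, Finite (B a)]
      [∀ a, Finite (B' a)] (f : ∀ a, B a ≃ B' a) (t : OpTerm k E A)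
      (s : ∀ a, OpTerm k E (B a)) :
      OpRel ρ S (.comp t fun a => .map (f a) (s a))
        (.map (Equiv.sigmaCongrRight f) (.comp t s))
  | one_comp {B : Type} [Finite B] (t : OpTerm k E B) :
      OpRel ρ S (.map (Equiv.uniqueSigma fun _ : Unit => B) (.comp .one fun _ => t)) t
  | comp_one {A : Type} [Finite A] (t : OpTerm k E A) :
      OpRel ρ S (.map (Equiv.sigmaPUnit A) (.comp t fun _ => .one)) t
  | comp_assoc {A : Type} {B : A → Type} {C : ∀ a, B a → Type} [Finite A] [∀ a, Finite (B a)]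
      [∀ a b, Finite (C a b)] (t : OpTerm k E A) (s : ∀ a, OpTerm k E (B a))
      (r : ∀ a b, OpTerm k E (C a b)) :
      OpRel ρ S (.map (Equiv.sigmaAssoc C) (.comp (.comp t s) fun x => r x.1 x.2))
        (.comp t fun a => .comp (s a) (r a))
  -- the generators
  | gen_add (x y : E) : OpRel ρ S (.gen (x + y)) (.add (.gen x) (.gen y))
  | gen_smul (c : k) (x : E) : OpRel ρ S (.gen (c • x)) (.smul c (.gen x))
  | gen_perm (σ : Equiv.Perm (Fin 2)) (x : E) : OpRel ρ S (.map σ (.gen x)) (.gen (ρ σ x))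

variable (ρ : Representation k (Equiv.Perm (Fin 2)) E) (S : ∀ A : Type, Set (OpTerm k E A))

/-- The congruence `OpRel` as a setoid. -/
def opSetoid (A : Type) : Setoid (OpTerm k E A) where
  r := OpRel ρ S
  iseqv := ⟨.refl, .symm, .trans⟩

/-- The components of the operad generated by the `𝕊₂`-module `E` subject to the relations `S`. -/
def PresObj (A : Type) : Type (max 1 u) := Quotient (opSetoid ρ S A)

/-- The operation denoted by an expression. -/
def PresObj.mk {A : Type} (t : OpTerm k E A) : PresObj ρ S A := Quotient.mk (opSetoid ρ S A) t

variable {ρ S}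

theorem PresObj.ind {A : Type} {motive : PresObj ρ S A → Prop}
    (h : ∀ t, motive (PresObj.mk ρ S t)) (x : PresObj ρ S A) : motive x :=
  Quotient.inductionOn x h

theorem PresObj.sound {A : Type} {s t : OpTerm k E A} (h : OpRel ρ S s t) :
    PresObj.mk ρ S s = PresObj.mk ρ S t := Quotient.sound h

theorem PresObj.exact {A : Type} {s t : OpTerm k E A}
    (h : PresObj.mk ρ S s = PresObj.mk ρ S t) : OpRel ρ S s t := Quotient.exact h

variable (ρ S)

/-- A representing expression. -/
noncomputable def PresObj.rep {A : Type} (x : PresObj ρ S A) : OpTerm k E A := Quotient.out x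

theorem PresObj.mk_rep {A : Type} (x : PresObj ρ S A) : PresObj.mk ρ S (PresObj.rep ρ S x) = x :=
  Quotient.out_eq x

instance PresObj.instAdd (A : Type) : Add (PresObj ρ S A) where
  add := Quotient.map₂ OpTerm.add fun _ _ h _ _ h' => .add_congr h h'

instance PresObj.instZero (A : Type) : Zero (PresObj ρ S A) where
  zero := PresObj.mk ρ S .zero

instance PresObj.instNeg (A : Type) : Neg (PresObj ρ S A) where
  neg := Quotient.map (OpTerm.smul (-1)) fun _ _ h => .smul_congr _ h

instance PresObj.addCommGroup (A : Type) : AddCommGroup (PresObj ρ S A) where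
  add_assoc x y z := by
    induction x using PresObj.ind; induction y using PresObj.ind; induction z using PresObj.ind
    exact PresObj.sound (.add_assoc _ _ _)
  add_comm x y := by
    induction x using PresObj.ind; induction y using PresObj.ind
    exact PresObj.sound (.add_comm _ _)
  zero_add x := by
    induction x using PresObj.ind
    exact PresObj.sound (.zero_add _)
  add_zero x := by
    induction x using PresObj.ind
    exact PresObj.sound (.trans (.add_comm _ _) (.zero_add _))
  neg_add_cancel x := by
    induction x using PresObj.ind
    exact PresObj.sound (.neg_add _)
  nsmul := nsmulRec
  zsmul := zsmulRec

theorem PresObj.mk_add {A : Type} (s t : OpTerm k E A) :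
    PresObj.mk ρ S (.add s t) = PresObj.mk ρ S s + PresObj.mk ρ S t := rfl

instance PresObj.instSMul (A : Type) : SMul k (PresObj ρ S A) where
  smul c := Quotient.map (OpTerm.smul c) fun _ _ h => .smul_congr _ h

theorem PresObj.mk_smul {A : Type} (c : k) (t : OpTerm k E A) :
    PresObj.mk ρ S (.smul c t) = c • PresObj.mk ρ S t := rfl

instance PresObj.instModule (A : Type) : Module k (PresObj ρ S A) :=
  Module.ofMinimalAxioms
    (fun c x y => by
      induction x using PresObj.ind; induction y using PresObj.ind
      exact PresObj.sound (.smul_add _ _ _))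
    (fun c d x => by
      induction x using PresObj.ind
      exact PresObj.sound (.add_smul _ _ _))
    (fun c d x => by
      induction x using PresObj.ind
      exact PresObj.sound (.mul_smul _ _ _))
    (fun x => by
      induction x using PresObj.ind
      exact PresObj.sound (.one_smul _))

/-- Relabelling. -/
def PresObj.map {A B : Type} (e : A ≃ B) : PresObj ρ S A →ₗ[k] PresObj ρ S B where
  toFun := Quotient.map (OpTerm.map e) fun _ _ h => .map_congr e h
  map_add' x y := by
    induction x using PresObj.ind; induction y using PresObj.ind
    exact PresObj.sound (.map_add _ _ _)
  map_smul' c x := by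
    induction x using PresObj.ind
    exact PresObj.sound (.map_smul _ _ _)

theorem PresObj.map_mk {A B : Type} (e : A ≃ B) (t : OpTerm k E A) :
    PresObj.map ρ S e (PresObj.mk ρ S t) = PresObj.mk ρ S (.map e t) := rfl

/-- Composition of operations; `comp_mk` says that it is the one induced by `OpTerm.comp`. -/
noncomputable def PresObj.compFun {A : Type} {B : A → Type} [Finite A] [∀ a, Finite (B a)]
    (x : PresObj ρ S A) (y : ∀ a, PresObj ρ S (B a)) : PresObj ρ S (Σ a, B a) :=
  PresObj.mk ρ S (.comp (PresObj.rep ρ S x) fun a => PresObj.rep ρ S (y a))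

theorem PresObj.compFun_mk {A : Type} {B : A → Type} [Finite A] [∀ a, Finite (B a)]
    (t : OpTerm k E A) (s : ∀ a, OpTerm k E (B a)) :
    PresObj.compFun ρ S (PresObj.mk ρ S t) (fun a => PresObj.mk ρ S (s a)) =
      PresObj.mk ρ S (.comp t s) :=
  PresObj.sound (.comp_congr (PresObj.exact (PresObj.mk_rep ρ S _))
    fun _ => PresObj.exact (PresObj.mk_rep ρ S _))

variable {ρ S} in
theorem PresObj.ind_fam {A : Type} {B : A → Type} {motive : (∀ a, PresObj ρ S (B a)) → Prop}
    (h : ∀ s : ∀ a, OpTerm k E (B a), motive fun a => PresObj.mk ρ S (s a))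
    (y : ∀ a, PresObj ρ S (B a)) : motive y := by
  have := h fun a => PresObj.rep ρ S (y a)
  simpa only [PresObj.mk_rep] using this

theorem PresObj.update_mk {A : Type} [DecidableEq A] {B : A → Type} (s : ∀ a, OpTerm k E (B a))
    (a : A) (x : OpTerm k E (B a)) :
    Function.update (fun a => PresObj.mk ρ S (s a)) a (PresObj.mk ρ S x) =
      fun b => PresObj.mk ρ S (Function.update s a x b) := by
  funext b
  by_cases h : b = a
  · subst h; simp
  · simp [h]

/-- Composition of operations as a multilinear map. -/
noncomputable def PresObj.comp {A : Type} {B : A → Type} [Finite A] [∀ a, Finite (B a)] :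
    PresObj ρ S A →ₗ[k]
      MultilinearMap k (fun a => PresObj ρ S (B a)) (PresObj ρ S (Σ a, B a)) where
  toFun x :=
    { toFun := PresObj.compFun ρ S x
      map_update_add' := fun y a u v => by
        induction x using PresObj.ind
        induction y using PresObj.ind_fam
        induction u using PresObj.ind; induction v using PresObj.ind
        simp only [← PresObj.mk_add, PresObj.update_mk, PresObj.compFun_mk]
        exact PresObj.sound (.comp_add _ _ _ _ _)
      map_update_smul' := fun y a c u => by
        induction x using PresObj.ind
        induction y using PresObj.ind_fam
        induction u using PresObj.ind
        simp only [← PresObj.mk_smul, PresObj.update_mk, PresObj.compFun_mk]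
        exact PresObj.sound (.comp_smul _ _ _ _ _) }
  map_add' x x' := by
    ext y
    induction x using PresObj.ind; induction x' using PresObj.ind
    induction y using PresObj.ind_fam
    simp only [← PresObj.mk_add, MultilinearMap.coe_mk, add_apply,
      PresObj.compFun_mk]
    exact PresObj.sound (.add_comp _ _ _)
  map_smul' c x := by
    ext y
    induction x using PresObj.ind
    induction y using PresObj.ind_fam
    simp only [← PresObj.mk_smul, MultilinearMap.coe_mk, smul_apply,
      PresObj.compFun_mk, RingHom.id_apply]
    exact PresObj.sound (.smul_comp _ _ _)

theorem PresObj.comp_mk {A : Type} {B : A → Type} [Finite A] [∀ a, Finite (B a)]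
    (t : OpTerm k E A) (s : ∀ a, OpTerm k E (B a)) :
    PresObj.comp ρ S (PresObj.mk ρ S t) (fun a => PresObj.mk ρ S (s a)) =
      PresObj.mk ρ S (.comp t s) :=
  PresObj.compFun_mk ρ S t s

/-- The operad generated by the `𝕊₂`-module `E` of binary operations subject to the relations `S`. -/
noncomputable def presentedOperad : SymmOperad.{u, max 1 u} k where
  obj A _ := PresObj ρ S A
  map e := PresObj.map ρ S e
  one := PresObj.mk ρ S .one
  comp := PresObj.comp ρ S
  map_refl p := by
    induction p using PresObj.ind
    exact PresObj.sound (.map_refl _)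
  map_trans e f p := by
    induction p using PresObj.ind
    exact PresObj.sound (.map_trans _ _ _)
  comp_map_left e p q := by
    induction p using PresObj.ind
    induction q using PresObj.ind_fam
    simp only [PresObj.map_mk, PresObj.comp_mk]
    exact PresObj.sound (.comp_map_left _ _ _)
  comp_map_right f p q := by
    induction p using PresObj.ind
    induction q using PresObj.ind_fam
    simp only [PresObj.map_mk, PresObj.comp_mk]
    exact PresObj.sound (.comp_map_right _ _ _)
  one_comp q := by
    induction q using PresObj.ind
    simp only [PresObj.map_mk, PresObj.comp_mk]
    exact PresObj.sound (.one_comp _)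
  comp_one p := by
    induction p using PresObj.ind
    simp only [PresObj.map_mk, PresObj.comp_mk]
    exact PresObj.sound (.comp_one _)
  comp_assoc {A B C} _ _ _ p q r := by
    induction p using PresObj.ind
    induction q using PresObj.ind_fam
    obtain ⟨r', rfl⟩ : ∃ r' : ∀ a b, OpTerm k E (C a b), r = fun a b => PresObj.mk ρ S (r' a b) :=
      ⟨fun a b => PresObj.rep ρ S (r a b), by simp only [PresObj.mk_rep]⟩
    simp only [PresObj.map_mk, PresObj.comp_mk]
    exact PresObj.sound (.comp_assoc _ _ _)

/-- The free operad `F(E)` on the `𝕊₂`-module `E` of binary operations. -/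
noncomputable def freeOperad : SymmOperad.{u, max 1 u} k := presentedOperad ρ fun _ => ∅

/-- The inclusion of the generators, `E → F(E)(2)`. -/
def freeGen : E →ₗ[k] (freeOperad ρ).obj (Fin 2) where
  toFun e := PresObj.mk ρ (fun _ => ∅) (.gen e)
  map_add' _ _ := PresObj.sound (.gen_add _ _)
  map_smul' _ _ := PresObj.sound (.gen_smul _ _)

/-! ### The arity-three component of the free operad

`F(E)(3)` is the direct sum of three copies of `E ⊗ E`: with the inputs `x₀, x₁, x₂` (indices
modulo `3`), the element `μ ⊗ ν` of the copy number `i` is the operation `μ(ν(xᵢ₊₁, xᵢ₊₂), xᵢ)`. -/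

/-- The space `(E ⊗ E)³` of compositions of two generators. -/
abbrev CubicSpace (k : Type u) [Field k] (E : Type u) [AddCommGroup E] [Module k E] : Type u :=
  Fin 3 → E ⊗[k] E

/-- The operation `μ(ν(xᵢ₊₁, xᵢ₊₂), xᵢ)`. -/
noncomputable def cubicNode (k : Type u) [Field k] {E : Type u} [AddCommGroup E] [Module k E]
    (i : Fin 3) (μ ν : E) : CubicSpace k E :=
  Pi.single i (μ ⊗ₜ[k] ν)

/-- The homomorphism `𝕊₃ → 𝕊₂` with kernel the cyclic permutations. -/
def orient : Equiv.Perm (Fin 3) →* Equiv.Perm (Fin 2) where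
  toFun σ := if Equiv.Perm.sign σ = 1 then 1 else Equiv.swap 0 1
  map_one' := by simp
  map_mul' := by decide

/-- The action of `𝕊₃` on `(E ⊗ E)³` by renaming the inputs: `σ` turns `μ(ν(xᵢ₊₁, xᵢ₊₂), xᵢ)` into
`μ(ν(x_{σ(i+1)}, x_{σ(i+2)}), x_{σ(i)})`, where `(σ(i+1), σ(i+2))` is `(σ(i)+1, σ(i)+2)` if `σ` is
even, and the reversed pair if `σ` is odd. -/
noncomputable def cubicRep : Representation k (Equiv.Perm (Fin 3)) (CubicSpace k E) where
  toFun σ := LinearMap.pi fun i =>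
    LinearMap.lTensor E (ρ (orient σ)) ∘ₗ LinearMap.proj (σ⁻¹ i)
  map_one' := by
    ext t i
    simp [Module.End.one_eq_id]
  map_mul' σ τ := by
    refine LinearMap.ext fun t => funext fun i => ?_
    simp only [map_mul, mul_inv_rev, Module.End.mul_eq_comp, LinearMap.lTensor_comp,
      LinearMap.pi_apply, LinearMap.comp_apply, LinearMap.proj_apply, Equiv.Perm.mul_apply]

/-- The numbers of inputs of the operations plugged into `μ` in `μ(ν(·, ·), ·)`. -/
abbrev innerArity : Fin 2 → Type := ![Fin 2, Unit]

instance innerArity.finite : ∀ a, Finite (innerArity a)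
  | 0 => inferInstanceAs (Finite (Fin 2))
  | 1 => inferInstanceAs (Finite Unit)

/-- The inputs of `μ(ν(·, ·), ·)` are labelled by `i + 1`, `i + 2`, `i`, in this order. -/
def cubicLeaves (i : Fin 3) : (Σ a, innerArity a) ≃ Fin 3 :=
  Equiv.trans
    { toFun := fun x => match x with
        | ⟨0, (0 : Fin 2)⟩ => 1
        | ⟨0, (1 : Fin 2)⟩ => 2
        | ⟨1, _⟩ => 0
      invFun := ![⟨1, ()⟩, ⟨0, (0 : Fin 2)⟩, ⟨0, (1 : Fin 2)⟩]
      left_inv := fun x => match x with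
        | ⟨0, (0 : Fin 2)⟩ => rfl
        | ⟨0, (1 : Fin 2)⟩ => rfl
        | ⟨1, _⟩ => rfl
      right_inv := fun x => by fin_cases x <;> rfl }
    (Equiv.addLeft i)

/-- The family of operations `(ν, id)`, plugged into `μ` in `μ(ν(·, ·), ·)`. -/
noncomputable def innerFamily (ν : E) : ∀ a, (freeOperad ρ).obj (innerArity a)
  | 0 => freeGen ρ ν
  | 1 => (freeOperad ρ).one

theorem innerFamily_eq (ν : E) :
    innerFamily ρ ν =
      Function.update (innerFamily ρ 0) (0 : Fin 2)
        (freeGen ρ ν : (freeOperad ρ).obj (innerArity 0)) := by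
  funext a
  match a with
  | 0 => rfl
  | 1 => rfl

/-- The operation `μ(ν(xᵢ₊₁, xᵢ₊₂), xᵢ)` of the free operad, as a function of `μ` and `ν`. -/
noncomputable def freeNode (i : Fin 3) : E →ₗ[k] E →ₗ[k] (freeOperad ρ).obj (Fin 3) :=
  LinearMap.mk₂ k
    (fun μ ν => (freeOperad ρ).map (cubicLeaves i)
      ((freeOperad ρ).comp (freeGen ρ μ) (innerFamily ρ ν)))
    (fun _ _ _ => by simp only [map_add, add_apply])
    (fun _ _ _ => by simp only [map_smul, smul_apply])
    (fun μ ν ν' => by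
      rw [innerFamily_eq ρ (ν + ν'), innerFamily_eq ρ ν, innerFamily_eq ρ ν',
        (freeGen ρ).map_add]
      exact (congrArg ((freeOperad ρ).map (cubicLeaves i))
        (((freeOperad ρ).comp (freeGen ρ μ)).map_update_add
          (innerFamily ρ 0) (0 : Fin 2) (freeGen ρ ν) (freeGen ρ ν'))).trans (map_add _ _ _))
    (fun c μ ν => by
      rw [innerFamily_eq ρ (c • ν), innerFamily_eq ρ ν, (freeGen ρ).map_smul]
      exact (congrArg ((freeOperad ρ).map (cubicLeaves i))
        (((freeOperad ρ).comp (freeGen ρ μ)).map_update_smul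
          (innerFamily ρ 0) (0 : Fin 2) c (freeGen ρ ν))).trans (map_smul _ _ _))

/-- The canonical map `(E ⊗ E)³ → F(E)(3)`. -/
noncomputable def cubicToFree : CubicSpace k E →ₗ[k] (freeOperad ρ).obj (Fin 3) :=
  LinearMap.lsum k (fun _ => E ⊗[k] E) k fun i => TensorProduct.lift (freeNode ρ i)

/-- The `𝕊₂`-module `E^∨`: the linear dual of `E` twisted by the sign representation. -/
noncomputable def signDual : Representation k (Equiv.Perm (Fin 2)) (Module.Dual k E) where
  toFun σ := Equiv.Perm.sign σ • ρ.dual σ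
  map_one' := by rw [map_one, map_one, one_smul]
  map_mul' σ τ := by
    rw [map_mul, map_mul, mul_smul, smul_mul_assoc, mul_smul_comm]

/-- The pairing between `(E^∨ ⊗ E^∨)³` and `(E ⊗ E)³`. -/
noncomputable def cubicPairing (f : CubicSpace k (Module.Dual k E)) : Module.Dual k (CubicSpace k E) :=
  ∑ i, TensorProduct.dualDistrib k E E (f i) ∘ₗ LinearMap.proj i

end Presentation

/-- Binary quadratic data: a finite-dimensional `𝕊₂`-module `E` of generating operations and an
`𝕊₃`-submodule `R` of `F(E)(3) = (E ⊗ E)³` of relations. -/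
structure QuadraticData (k : Type u) [Field k] where
  E : Type u
  [addCommGroup : AddCommGroup E]
  [module : Module k E]
  [finite : FiniteDimensional k E]
  ρ : Representation k (Equiv.Perm (Fin 2)) E
  R : Submodule k (CubicSpace k E)
  stable : ∀ (σ : Equiv.Perm (Fin 3)), ∀ t ∈ R, cubicRep ρ σ t ∈ R

namespace QuadraticData

attribute [instance] QuadraticData.addCommGroup QuadraticData.module QuadraticData.finite

variable {k : Type u} [Field k]

/-- The expressions with three inputs that represent an element of `R` in the free operad. -/
inductive IsRelator (D : QuadraticData k) : ∀ A : Type, OpTerm k D.E A → Prop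
  | intro (t : OpTerm k D.E (Fin 3)) (r : CubicSpace k D.E) (hr : r ∈ D.R)
      (h : PresObj.mk D.ρ (fun _ => ∅) t = cubicToFree D.ρ r) : IsRelator D (Fin 3) t

/-- The quadratic operad `F(E)/(R)`: the operad generated by `E` in which every expression that
represents an element of `R` in the free operad is zero. -/
noncomputable def operad (D : QuadraticData k) : SymmOperad.{u, max 1 u} k :=
  presentedOperad D.ρ fun A => {t | D.IsRelator A t}

theorem dualDistrib_signDual {E : Type u} [AddCommGroup E] [Module k E]
    (ρ : Representation k (Equiv.Perm (Fin 2)) E) (τ : Equiv.Perm (Fin 2))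
    (x : Module.Dual k E ⊗[k] Module.Dual k E) (y : E ⊗[k] E) :
    TensorProduct.dualDistrib k E E (LinearMap.lTensor _ (signDual ρ τ) x) y =
      Equiv.Perm.sign τ • TensorProduct.dualDistrib k E E x (LinearMap.lTensor _ (ρ τ⁻¹) y) := by
  induction x with
  | zero => simp
  | add a b ha hb => simp only [map_add, LinearMap.add_apply, ha, hb, smul_add]
  | tmul f g =>
    induction y with
    | zero => simp
    | add a b ha hb => simp only [map_add, ha, hb, smul_add]
    | tmul a b =>
      rcases Int.units_eq_one_or (Equiv.Perm.sign τ) with h | h <;>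
        simp [signDual, h, Module.Dual.transpose_apply]

/-- The Koszul dual: generators `E^∨ = E^* ⊗ sgn`, relations the annihilator `R^⊥` of `R`. -/
noncomputable def koszulDual (D : QuadraticData k) : QuadraticData k where
  E := Module.Dual k D.E
  ρ := signDual D.ρ
  R :=
    { carrier := {f | ∀ r ∈ D.R, cubicPairing f r = 0}
      add_mem' := fun {f g} hf hg r hr => by
        have h1 := hf r hr
        have h2 := hg r hr
        simp only [cubicPairing, LinearMap.sum_apply, LinearMap.comp_apply] at h1 h2 ⊢
        simp only [Pi.add_apply, map_add, LinearMap.add_apply, Finset.sum_add_distrib, h1, h2,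
          add_zero]
      zero_mem' := fun r _ => by simp [cubicPairing]
      smul_mem' := fun c f hf r hr => by
        have h1 := hf r hr
        simp only [cubicPairing, LinearMap.sum_apply, LinearMap.comp_apply] at h1 ⊢
        simp only [Pi.smul_apply, map_smul, LinearMap.smul_apply, ← Finset.smul_sum, h1,
          smul_zero] }
  stable := fun σ f hf r hr => by
    have h := hf _ (D.stable σ⁻¹ r hr)
    simp only [cubicPairing, LinearMap.sum_apply, LinearMap.comp_apply, cubicRep,
      LinearMap.proj_apply, MonoidHom.coe_mk, OneHom.coe_mk, LinearMap.pi_apply, map_inv,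
      inv_inv] at h ⊢
    simp only [dualDistrib_signDual]
    rw [← Finset.smul_sum, ← Equiv.sum_comp σ]
    simp only [Equiv.Perm.inv_def, Equiv.symm_apply_apply] at h ⊢
    rw [h, smul_zero]

end QuadraticData

/-! ### The operad of `δ`-Poisson algebras

A `δ`-Poisson algebra is a vector space with a commutative associative product `x · y` and a Lie
bracket `{x, y}` such that `{x · y, z} = δ (x · {y, z} + {x, z} · y)`. -/

namespace DeltaPoisson

/-- The `𝕊₂`-module spanned by a commutative and by an anticommutative operation. -/
def gens : Representation ℂ (Equiv.Perm (Fin 2)) (ℂ × ℂ) where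
  toFun σ := LinearMap.prodMap LinearMap.id (Equiv.Perm.sign σ • LinearMap.id)
  map_one' := by ext <;> simp
  map_mul' σ τ := by ext <;> simp [mul_smul, smul_comm (Equiv.Perm.sign σ)]

/-- The product `x₀ · x₁`. -/
def mul : ℂ × ℂ := (1, 0)

/-- The bracket `{x₀, x₁}`. -/
def bracket : ℂ × ℂ := (0, 1)

/-- `(x₀ · x₁) · x₂ - x₀ · (x₁ · x₂)`; by commutativity the second monomial is `(x₁ · x₂) · x₀`. -/
noncomputable def assoc : CubicSpace ℂ (ℂ × ℂ) :=
  cubicNode ℂ 2 mul mul - cubicNode ℂ 0 mul mul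

/-- `{{x₀, x₁}, x₂} + {{x₁, x₂}, x₀} + {{x₂, x₀}, x₁}`. -/
noncomputable def jacobi : CubicSpace ℂ (ℂ × ℂ) :=
  cubicNode ℂ 2 bracket bracket + cubicNode ℂ 0 bracket bracket + cubicNode ℂ 1 bracket bracket

/-- `{x₀ · x₁, x₂} - δ (x₀ · {x₁, x₂} + {x₀, x₂} · x₁)`, where `x₀ · {x₁, x₂} = {x₁, x₂} · x₀` and
`{x₀, x₂} · x₁ = - {x₂, x₀} · x₁`. -/
noncomputable def leibniz (δ : ℂ) : CubicSpace ℂ (ℂ × ℂ) :=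
  cubicNode ℂ 2 bracket mul - δ • (cubicNode ℂ 0 mul bracket - cubicNode ℂ 1 mul bracket)

/-- The defining quadratic data of `δ`-Poisson algebras; the relations are the `𝕊₃`-submodule
generated by associativity, the Jacobi identity and the `δ`-Leibniz rule. -/
noncomputable def data (δ : ℂ) : QuadraticData ℂ where
  E := ℂ × ℂ
  ρ := gens
  R := Submodule.span ℂ
    {t | ∃ σ : Equiv.Perm (Fin 3), ∃ r ∈ ({assoc, jacobi, leibniz δ} : Set (CubicSpace ℂ (ℂ × ℂ))),
      t = cubicRep gens σ r}
  stable := fun σ t ht => by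
    induction ht using Submodule.span_induction with
    | mem x hx =>
      obtain ⟨τ, r, hr, rfl⟩ := hx
      refine Submodule.subset_span ⟨σ * τ, r, hr, ?_⟩
      rw [map_mul, Module.End.mul_apply]
    | zero => rw [map_zero]; exact Submodule.zero_mem _
    | add x y _ _ hx hy => rw [map_add]; exact Submodule.add_mem _ hx hy
    | smul c x _ hx => rw [map_smul]; exact Submodule.smul_mem _ c hx

end DeltaPoisson

/-- The operad `δ-P` governing `δ`-Poisson algebras. -/
noncomputable def deltaPoissonOperad (δ : ℂ) : SymmOperad.{0, 1} ℂ := (DeltaPoisson.data δ).operad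

/-- The Koszul dual operad `δ-P^!`. -/
noncomputable def deltaPoissonDualOperad (δ : ℂ) : SymmOperad.{0, 1} ℂ :=
  (DeltaPoisson.data δ).koszulDual.operad

/-!
Exchanging the two generators makes the `δ`-Poisson operad self-dual. The twist by the sign turns
the symmetric product into an antisymmetric dual generator and the antisymmetric bracket into a
symmetric one, so `f ↦ (f bracket, f mul)` is an isomorphism `E^∨ ≃ E` of `𝕊₂`-modules
(`DeltaPoisson.swapDual`). It carries `R^⊥` onto `R`. Writing `aᵢ`, `bᵢ`, `cᵢ`, `dᵢ` for the
coefficients of `mul ⊗ mul`, `mul ⊗ bracket`, `bracket ⊗ mul`, `bracket ⊗ bracket` in the `i`-th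
copy of `E ⊗ E`, both `R` and the image of `R^⊥` are the six-dimensional space
`∑ aᵢ = 0`, `bᵢ = δ (cᵢ₊₁ - cᵢ₊₂)`, `d₀ = d₁ = d₂`
(`DeltaPoisson.mem_relations_iff`, `DeltaPoisson.mem_dual_relations_iff`): in the dual,
associativity and the Jacobi identity exchange roles, and the `δ`-Leibniz rule goes to itself.

It remains to see that a quadratic operad depends functorially on its data. Replacing the
generators in a formal expression respects the defining congruence
(`OpRel.rename`) and is compatible with the map `(E ⊗ E)³ → F(E)(3)` (`freeRename_cubicToFree`), so an
equivariant isomorphism of generators that identifies the relations induces an isomorphism of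
operads (`QuadraticData.operadIso`). Injectivity of `(E ⊗ E)³ → F(E)(3)` is not needed.
-/

open scoped TensorProduct

/-! ### Functoriality of presented operads -/

section Rename

variable {k E E' : Type u}

/-- Replacement of every generator `e` in a formal expression by `f e`. -/
def OpTerm.rename (f : E → E') : ∀ {A : Type}, OpTerm k E A → OpTerm k E' A
  | _, .gen e => .gen (f e)
  | _, .one => .one
  | _, .zero => .zero
  | _, .add s t => .add (s.rename f) (t.rename f)
  | _, .smul c t => .smul c (t.rename f)
  | _, .map e t => .map e (t.rename f)
  | _, @OpTerm.comp _ _ _ _ _ _ t s => .comp (t.rename f) fun a => (s a).rename f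

theorem OpTerm.rename_of_leftInverse {f : E → E'} {g : E' → E} (h : Function.LeftInverse g f)
    {A : Type} (t : OpTerm k E A) : (t.rename f).rename g = t := by
  induction t with
  | gen e => simp only [OpTerm.rename, h e]
  | one => rfl
  | zero => rfl
  | add s t hs ht => simp only [OpTerm.rename, hs, ht]
  | smul c t ht => simp only [OpTerm.rename, ht]
  | map e t ht => simp only [OpTerm.rename, ht]
  | comp t s ht hs => simp only [OpTerm.rename, ht, hs]

theorem OpTerm.rename_update (f : E → E') {A : Type} [DecidableEq A] {B : A → Type}
    (s : ∀ a, OpTerm k E (B a)) (a : A) (x : OpTerm k E (B a)) :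
    (fun b => (Function.update s a x b).rename f) =
      Function.update (fun b => (s b).rename f) a (x.rename f) := by
  funext b
  by_cases h : b = a
  · subst h; simp
  · simp [h]

/-- The expressions denoting the members of `innerFamily`. -/
def innerTerms (k : Type u) {E : Type u} (ν : E) : ∀ a, OpTerm k E (innerArity a)
  | 0 => .gen ν
  | 1 => .one

theorem innerTerms_rename (φ : E → E') (ν : E) :
    (fun a => (innerTerms k ν a).rename φ) = innerTerms k (φ ν) := by
  funext a
  match a with
  | 0 => rfl
  | 1 => rfl

end Rename

section Functoriality

variable {k : Type u} [Field k] {E : Type u} [AddCommGroup E] [Module k E]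
  {E' : Type u} [AddCommGroup E'] [Module k E']

variable {ρ : Representation k (Equiv.Perm (Fin 2)) E}
  {ρ' : Representation k (Equiv.Perm (Fin 2)) E'}
  {S : ∀ A : Type, Set (OpTerm k E A)} {S' : ∀ A : Type, Set (OpTerm k E' A)}

/-- An equivariant map of generators that sends the relations `S` to consequences of `S'` respects
the congruences. -/
theorem OpRel.rename (φ : E →ₗ[k] E') (hφ : ∀ σ x, φ (ρ σ x) = ρ' σ (φ x))
    (hS : ∀ (A : Type) (t : OpTerm k E A), t ∈ S A → OpRel ρ' S' (t.rename φ) .zero)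
    {A : Type} {s t : OpTerm k E A} (h : OpRel ρ S s t) :
    OpRel ρ' S' (s.rename φ) (t.rename φ) := by
  induction h with
  | of t h => exact hS _ t h
  | refl t => exact .refl _
  | symm _ ih => exact .symm ih
  | trans _ _ ih₁ ih₂ => exact .trans ih₁ ih₂
  | add_congr _ _ ih₁ ih₂ => exact .add_congr ih₁ ih₂
  | smul_congr c _ ih => exact .smul_congr c ih
  | map_congr e _ ih => exact .map_congr e ih
  | comp_congr _ _ ih₁ ih₂ => exact .comp_congr ih₁ ih₂
  | add_assoc s t r => exact .add_assoc _ _ _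
  | add_comm s t => exact .add_comm _ _
  | zero_add t => exact .zero_add _
  | neg_add t => exact .neg_add _
  | one_smul t => exact .one_smul _
  | mul_smul c d t => exact .mul_smul _ _ _
  | smul_add c s t => exact .smul_add _ _ _
  | add_smul c d t => exact .add_smul _ _ _
  | map_add e s t => exact .map_add _ _ _
  | map_smul e c t => exact .map_smul _ _ _
  | add_comp t t' s => exact .add_comp _ _ _
  | smul_comp c t s => exact .smul_comp _ _ _
  | comp_add t s a x y =>
    simp only [OpTerm.rename, OpTerm.rename_update]
    exact .comp_add _ _ _ _ _
  | comp_smul t s a c x =>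
    simp only [OpTerm.rename, OpTerm.rename_update]
    exact .comp_smul _ _ _ _ _
  | map_refl t => exact .map_refl _
  | map_trans e f t => exact .map_trans _ _ _
  | comp_map_left e t s => exact .comp_map_left e (t.rename φ) fun a => (s a).rename φ
  | comp_map_right f t s => exact .comp_map_right f (t.rename φ) fun a => (s a).rename φ
  | one_comp t => exact .one_comp _
  | comp_one t => exact .comp_one _
  | comp_assoc t s r =>
    exact .comp_assoc (t.rename φ) (fun a => (s a).rename φ) fun a b => (r a b).rename φ
  | gen_add x y =>
    simp only [OpTerm.rename, _root_.map_add]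
    exact .gen_add _ _
  | gen_smul c x =>
    simp only [OpTerm.rename, _root_.map_smul]
    exact .gen_smul _ _
  | gen_perm σ x =>
    simp only [OpTerm.rename, hφ]
    exact .gen_perm _ _

/-- The linear map on the components of presented operads induced by a map of generators. -/
def PresObj.rename (φ : E →ₗ[k] E') (hφ : ∀ σ x, φ (ρ σ x) = ρ' σ (φ x))
    (hS : ∀ (A : Type) (t : OpTerm k E A), t ∈ S A → OpRel ρ' S' (t.rename φ) .zero)
    (A : Type) : PresObj ρ S A →ₗ[k] PresObj ρ' S' A where
  toFun := Quotient.map (OpTerm.rename φ) fun _ _ h => OpRel.rename φ hφ hS h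
  map_add' x y := by
    induction x using PresObj.ind; induction y using PresObj.ind
    rfl
  map_smul' c x := by
    induction x using PresObj.ind
    rfl

/-- An equivariant isomorphism of generators under which each set of relations follows from the
other one induces an isomorphism of presented operads. -/
noncomputable def presentedOperadIso (φ : E ≃ₗ[k] E') (hφ : ∀ σ x, φ (ρ σ x) = ρ' σ (φ x))
    (hS : ∀ (A : Type) (t : OpTerm k E A), t ∈ S A → OpRel ρ' S' (t.rename φ) .zero)
    (hS' : ∀ (A : Type) (t : OpTerm k E' A), t ∈ S' A → OpRel ρ S (t.rename φ.symm) .zero) :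
    (presentedOperad ρ S).Iso (presentedOperad ρ' S') where
  equiv A _ := LinearEquiv.ofLinearMap (PresObj.rename φ.toLinearMap hφ hS A)
    (PresObj.rename φ.symm.toLinearMap
      (fun σ x => by
        apply φ.injective
        simp only [LinearEquiv.coe_coe, hφ, LinearEquiv.apply_symm_apply]) hS' A)
    (by
      refine LinearMap.ext fun x => ?_
      induction x using PresObj.ind with | h t
      exact congrArg (PresObj.mk ρ' S') (t.rename_of_leftInverse φ.apply_symm_apply))
    (by
      refine LinearMap.ext fun x => ?_
      induction x using PresObj.ind with | h t
      exact congrArg (PresObj.mk ρ S) (t.rename_of_leftInverse φ.symm_apply_apply))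
  equiv_map e p := by
    induction p using PresObj.ind
    rfl
  equiv_one := rfl
  equiv_comp p q := by
    induction p using PresObj.ind with | h t
    induction q using PresObj.ind_fam with | h s
    refine (congrArg (PresObj.rename φ.toLinearMap hφ hS _) (PresObj.comp_mk ρ S t s)).trans ?_
    exact (PresObj.comp_mk ρ' S' (t.rename φ) fun a => (s a).rename φ).symm

/-! ### Functoriality of quadratic operads -/

/-- The map `(E ⊗ E)³ → (E' ⊗ E')³` induced by a map of generators. -/
noncomputable def cubicMap (φ : E →ₗ[k] E') : CubicSpace k E →ₗ[k] CubicSpace k E' :=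
  LinearMap.pi fun i => TensorProduct.map φ φ ∘ₗ LinearMap.proj i

theorem cubicMap_apply (φ : E →ₗ[k] E') (r : CubicSpace k E) (i : Fin 3) :
    cubicMap φ r i = TensorProduct.map φ φ (r i) := rfl

/-- The map of free operads induced by an equivariant map of generators. -/
noncomputable def freeRename (φ : E →ₗ[k] E') (hφ : ∀ σ x, φ (ρ σ x) = ρ' σ (φ x)) (A : Type) :
    PresObj ρ (fun _ => ∅) A →ₗ[k] PresObj ρ' (fun _ => ∅) A :=
  PresObj.rename φ hφ (fun _ _ h => h.elim) A

theorem innerFamily_eq_mk (ρ : Representation k (Equiv.Perm (Fin 2)) E) (ν : E) :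
    innerFamily ρ ν = fun a => PresObj.mk ρ (fun _ => ∅) (innerTerms k ν a) := by
  funext a
  match a with
  | 0 => rfl
  | 1 => rfl

theorem freeNode_eq_mk (ρ : Representation k (Equiv.Perm (Fin 2)) E) (i : Fin 3) (μ ν : E) :
    freeNode ρ i μ ν = PresObj.mk ρ (fun _ => ∅)
      (.map (cubicLeaves i) (.comp (.gen μ) (innerTerms k ν))) := by
  change PresObj.map ρ _ (cubicLeaves i) (PresObj.comp ρ _ _ (innerFamily ρ ν)) = _
  rw [innerFamily_eq_mk]
  exact congrArg (PresObj.map ρ _ (cubicLeaves i)) (PresObj.comp_mk ρ _ _ _)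

theorem freeRename_freeNode (φ : E →ₗ[k] E') (hφ : ∀ σ x, φ (ρ σ x) = ρ' σ (φ x)) (i : Fin 3)
    (μ ν : E) :
    freeRename φ hφ (Fin 3) (freeNode ρ i μ ν) = freeNode ρ' i (φ μ) (φ ν) := by
  rw [freeNode_eq_mk, freeNode_eq_mk, ← innerTerms_rename]
  rfl

theorem freeRename_cubicToFree (φ : E →ₗ[k] E') (hφ : ∀ σ x, φ (ρ σ x) = ρ' σ (φ x))
    (r : CubicSpace k E) :
    freeRename φ hφ (Fin 3) (cubicToFree ρ r) = cubicToFree ρ' (cubicMap φ r) := by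
  simp only [cubicToFree, LinearMap.lsum_apply, LinearMap.sum_apply, LinearMap.comp_apply,
    LinearMap.proj_apply, cubicMap_apply]
  refine (map_sum (freeRename φ hφ (Fin 3)) _ _).trans (Finset.sum_congr rfl fun i _ => ?_)
  induction r i with
  | zero => simp only [map_zero]; exact map_zero (freeRename φ hφ (Fin 3))
  | add x y hx hy =>
    simp only [map_add]
    exact (map_add (freeRename φ hφ (Fin 3)) _ _).trans (congrArg₂ (· + ·) hx hy)
  | tmul μ ν =>
    simp only [TensorProduct.lift.tmul, TensorProduct.map_tmul]
    exact freeRename_freeNode φ hφ i μ ν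

theorem QuadraticData.IsRelator.rename {D D' : QuadraticData k} (φ : D.E →ₗ[k] D'.E)
    (hφ : ∀ σ x, φ (D.ρ σ x) = D'.ρ σ (φ x)) (hR : ∀ r ∈ D.R, cubicMap φ r ∈ D'.R)
    {A : Type} {t : OpTerm k D.E A} (ht : D.IsRelator A t) : D'.IsRelator A (t.rename φ) := by
  obtain ⟨t, r, hr, h⟩ := ht
  refine .intro _ (cubicMap φ r) (hR r hr) ?_
  rw [← freeRename_cubicToFree φ hφ, ← h]
  rfl

/-- An equivariant isomorphism of generators that identifies the relations induces an isomorphism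
of quadratic operads. -/
noncomputable def QuadraticData.operadIso {D D' : QuadraticData k} (φ : D.E ≃ₗ[k] D'.E)
    (hφ : ∀ σ x, φ (D.ρ σ x) = D'.ρ σ (φ x))
    (hR : ∀ r, r ∈ D.R ↔ cubicMap φ.toLinearMap r ∈ D'.R) : D.operad.Iso D'.operad :=
  presentedOperadIso φ hφ
    (fun _ t ht => .of _ (IsRelator.rename φ.toLinearMap hφ (fun r => (hR r).1) ht))
    (fun _ t ht => .of _ (IsRelator.rename φ.symm.toLinearMap
      (fun σ x => by
        apply φ.injective
        simp only [LinearEquiv.coe_coe, hφ, LinearEquiv.apply_symm_apply])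
      (fun r hr => by
        rw [hR]
        convert hr
        funext i
        rw [cubicMap_apply, cubicMap_apply, ← LinearMap.comp_apply, ← TensorProduct.map_comp]
        simp) ht))

end Functoriality

/-! ### The relations of `δ`-Poisson algebras -/

namespace DeltaPoisson

/-- The coefficient of `p ⊗ q` in the monomial basis, where `p` and `q` are given by their
coordinate forms. -/
noncomputable def coord (p q : Module.Dual ℂ (ℂ × ℂ)) : (ℂ × ℂ) ⊗[ℂ] (ℂ × ℂ) →ₗ[ℂ] ℂ :=
  TensorProduct.dualDistrib ℂ (ℂ × ℂ) (ℂ × ℂ) (p ⊗ₜ q)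

theorem coord_tmul (p q : Module.Dual ℂ (ℂ × ℂ)) (x y : ℂ × ℂ) :
    coord p q (x ⊗ₜ y) = p x * q y := TensorProduct.dualDistrib_apply _ _ _ _

/-- The coordinate form of `mul`. -/
abbrev mulForm : Module.Dual ℂ (ℂ × ℂ) := LinearMap.fst ℂ ℂ ℂ

/-- The coordinate form of `bracket`. -/
abbrev bracketForm : Module.Dual ℂ (ℂ × ℂ) := LinearMap.snd ℂ ℂ ℂ

theorem eq_mul_add_bracket (x : ℂ × ℂ) : x = x.1 • mul + x.2 • bracket := by
  ext <;> simp [mul, bracket]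

theorem tensor_eq (x : (ℂ × ℂ) ⊗[ℂ] (ℂ × ℂ)) :
    x = coord mulForm mulForm x • (mul ⊗ₜ[ℂ] mul)
      + coord mulForm bracketForm x • (mul ⊗ₜ[ℂ] bracket)
      + coord bracketForm mulForm x • (bracket ⊗ₜ[ℂ] mul)
      + coord bracketForm bracketForm x • (bracket ⊗ₜ[ℂ] bracket) := by
  induction x with
  | zero => simp
  | add x y hx hy =>
    nth_rewrite 1 [hx, hy]
    simp only [map_add, add_smul]
    abel
  | tmul x y =>
    nth_rewrite 1 [eq_mul_add_bracket x, eq_mul_add_bracket y]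
    simp only [coord_tmul, LinearMap.fst_apply, LinearMap.snd_apply, TensorProduct.add_tmul,
      TensorProduct.tmul_add, TensorProduct.smul_tmul_smul]
    abel

/-- The linear equations that cut out the relations of `δ`-Poisson algebras. -/
structure Equations (δ : ℂ) (r : CubicSpace ℂ (ℂ × ℂ)) : Prop where
  mul_mul : ∑ i, coord mulForm mulForm (r i) = 0
  mul_bracket (i : Fin 3) : coord mulForm bracketForm (r i) =
    δ * (coord bracketForm mulForm (r (i + 1)) - coord bracketForm mulForm (r (i + 2)))
  bracket_bracket (i j : Fin 3) :
    coord bracketForm bracketForm (r i) = coord bracketForm bracketForm (r j)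

theorem Equations.add {δ : ℂ} {r s : CubicSpace ℂ (ℂ × ℂ)} (hr : Equations δ r)
    (hs : Equations δ s) : Equations δ (r + s) where
  mul_mul := by
    simp only [Pi.add_apply, map_add, Finset.sum_add_distrib, hr.mul_mul, hs.mul_mul, add_zero]
  mul_bracket i := by
    simp only [Pi.add_apply, map_add, hr.mul_bracket i, hs.mul_bracket i]
    ring
  bracket_bracket i j := by
    simp only [Pi.add_apply, map_add, hr.bracket_bracket i j, hs.bracket_bracket i j]

theorem Equations.smul {δ : ℂ} {r : CubicSpace ℂ (ℂ × ℂ)} (c : ℂ) (hr : Equations δ r) :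
    Equations δ (c • r) where
  mul_mul := by
    simp only [Pi.smul_apply, map_smul, ← Finset.smul_sum, hr.mul_mul, smul_zero]
  mul_bracket i := by
    simp only [Pi.smul_apply, map_smul, smul_eq_mul, hr.mul_bracket i]
    ring
  bracket_bracket i j := by
    simp only [Pi.smul_apply, map_smul, hr.bracket_bracket i j]

theorem cubicRep_apply (σ : Equiv.Perm (Fin 3)) (r : CubicSpace ℂ (ℂ × ℂ)) (i : Fin 3) :
    cubicRep gens σ r i = LinearMap.lTensor (ℂ × ℂ) (gens (orient σ)) (r (σ⁻¹ i)) := rfl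

theorem coord_mulForm_lTensor (p : Module.Dual ℂ (ℂ × ℂ)) (τ : Equiv.Perm (Fin 2))
    (x : (ℂ × ℂ) ⊗[ℂ] (ℂ × ℂ)) :
    coord p mulForm (LinearMap.lTensor (ℂ × ℂ) (gens τ) x) = coord p mulForm x := by
  induction x with
  | zero => simp
  | add x y hx hy => simp only [map_add, hx, hy]
  | tmul x y => simp [coord_tmul, gens]

theorem coord_bracketForm_lTensor (p : Module.Dual ℂ (ℂ × ℂ)) (τ : Equiv.Perm (Fin 2))
    (x : (ℂ × ℂ) ⊗[ℂ] (ℂ × ℂ)) :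
    coord p bracketForm (LinearMap.lTensor (ℂ × ℂ) (gens τ) x) =
      Equiv.Perm.sign τ • coord p bracketForm x := by
  induction x with
  | zero => simp
  | add x y hx hy => simp only [map_add, hx, hy, smul_add]
  | tmul x y =>
    rcases Int.units_eq_one_or (Equiv.Perm.sign τ) with h | h <;> simp [coord_tmul, gens, h]

/-- A permutation of `Fin 3` either preserves or reverses the cyclic order. -/
theorem cyclic_or_anticyclic (σ : Equiv.Perm (Fin 3)) :
    (Equiv.Perm.sign (orient σ) = 1 ∧
        ∀ i, σ⁻¹ (i + 1) = σ⁻¹ i + 1 ∧ σ⁻¹ (i + 2) = σ⁻¹ i + 2) ∨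
      (Equiv.Perm.sign (orient σ) = -1 ∧
        ∀ i, σ⁻¹ (i + 1) = σ⁻¹ i + 2 ∧ σ⁻¹ (i + 2) = σ⁻¹ i + 1) := by
  revert σ
  decide

theorem Equations.cubicRep {δ : ℂ} {r : CubicSpace ℂ (ℂ × ℂ)} (hr : Equations δ r)
    (σ : Equiv.Perm (Fin 3)) : Equations δ (cubicRep gens σ r) where
  mul_mul := by
    simp only [cubicRep_apply, coord_mulForm_lTensor]
    exact (Equiv.sum_comp σ⁻¹ fun i => coord mulForm mulForm (r i)).trans hr.mul_mul
  mul_bracket i := by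
    simp only [cubicRep_apply, coord_mulForm_lTensor, coord_bracketForm_lTensor]
    rcases cyclic_or_anticyclic σ with ⟨h, h'⟩ | ⟨h, h'⟩ <;>
      rw [h, (h' i).1, (h' i).2, hr.mul_bracket]
    · rw [one_smul]
    · simp only [Units.neg_smul, one_smul]
      ring
  bracket_bracket i j := by
    simp only [cubicRep_apply, coord_bracketForm_lTensor, hr.bracket_bracket (σ⁻¹ i) (σ⁻¹ j)]

theorem equations_assoc (δ : ℂ) : Equations δ assoc where
  mul_mul := by
    simp [Fin.sum_univ_three, assoc, cubicNode, coord_tmul, mul]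
  mul_bracket i := by
    fin_cases i <;> simp [assoc, cubicNode, coord_tmul, mul]
  bracket_bracket i j := by
    fin_cases i <;> fin_cases j <;> simp [assoc, cubicNode, coord_tmul, mul]

theorem equations_jacobi (δ : ℂ) : Equations δ jacobi where
  mul_mul := by
    simp [Fin.sum_univ_three, jacobi, cubicNode, coord_tmul, bracket]
  mul_bracket i := by
    fin_cases i <;> simp [jacobi, cubicNode, coord_tmul, bracket]
  bracket_bracket i j := by
    fin_cases i <;> fin_cases j <;> simp [jacobi, cubicNode, coord_tmul, bracket]

theorem equations_leibniz (δ : ℂ) : Equations δ (leibniz δ) where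
  mul_mul := by
    simp [Fin.sum_univ_three, leibniz, cubicNode, coord_tmul, mul, bracket]
  mul_bracket i := by
    fin_cases i <;> simp [leibniz, cubicNode, coord_tmul, mul, bracket]
  bracket_bracket i j := by
    fin_cases i <;> fin_cases j <;> simp [leibniz, cubicNode, coord_tmul, mul, bracket]

theorem cubicRep_cubicNode (σ : Equiv.Perm (Fin 3)) (i : Fin 3) (μ ν : ℂ × ℂ) :
    cubicRep gens σ (cubicNode ℂ i μ ν) = cubicNode ℂ (σ i) μ (gens (orient σ) ν) := by
  funext j
  obtain ⟨j, rfl⟩ := σ.surjective j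
  rw [cubicRep_apply, Equiv.Perm.inv_def, Equiv.symm_apply_apply]
  by_cases h : j = i
  · subst h; simp [cubicNode]
  · simp [cubicNode, h]

theorem cubicRep_addLeft_cubicNode (j i : Fin 3) (μ ν : ℂ × ℂ) :
    cubicRep gens (Equiv.addLeft j) (cubicNode ℂ i μ ν) = cubicNode ℂ (j + i) μ ν := by
  have h : orient (Equiv.addLeft j) = 1 := by
    revert j
    decide
  rw [cubicRep_cubicNode, h, map_one]
  rfl

/-- The relations of `data δ`, as a submodule of `(E ⊗ E)³` with `E` written out. -/
noncomputable def relations (δ : ℂ) : Submodule ℂ (CubicSpace ℂ (ℂ × ℂ)) := (data δ).R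

theorem cubicRep_mem_relations {δ : ℂ} (σ : Equiv.Perm (Fin 3)) {r : CubicSpace ℂ (ℂ × ℂ)}
    (hr : r ∈ ({assoc, jacobi, leibniz δ} : Set (CubicSpace ℂ (ℂ × ℂ)))) :
    cubicRep gens σ r ∈ relations δ :=
  Submodule.subset_span ⟨σ, r, hr, rfl⟩

theorem jacobi_mem (δ : ℂ) : jacobi ∈ relations δ := by
  simpa using cubicRep_mem_relations (δ := δ) (r := jacobi) 1 (by simp)

theorem assoc_rotate_mem (δ : ℂ) (i : Fin 3) :
    cubicNode ℂ (i + 2) mul mul - cubicNode ℂ i mul mul ∈ relations δ := by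
  have h := cubicRep_mem_relations (δ := δ) (r := assoc) (Equiv.addLeft i) (by simp)
  rwa [assoc, map_sub, cubicRep_addLeft_cubicNode, cubicRep_addLeft_cubicNode, add_zero] at h

theorem leibniz_rotate_mem (δ : ℂ) (i : Fin 3) :
    cubicNode ℂ i bracket mul
      - δ • (cubicNode ℂ (i + 1) mul bracket - cubicNode ℂ (i + 2) mul bracket) ∈ relations δ := by
  have h := cubicRep_mem_relations (δ := δ) (r := leibniz δ) (Equiv.addLeft (i + 1)) (by simp)
  have h₁ : i + 1 + 2 = i := by
    rw [add_assoc]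
    exact add_zero i
  have h₂ : i + 1 + 1 = i + 2 := add_assoc i 1 1
  rwa [leibniz, map_sub, map_smul, map_sub, cubicRep_addLeft_cubicNode, cubicRep_addLeft_cubicNode,
    cubicRep_addLeft_cubicNode, h₁, h₂, add_zero] at h

theorem cubic_eq (r : CubicSpace ℂ (ℂ × ℂ)) :
    r = ∑ i, (coord mulForm mulForm (r i) • cubicNode ℂ i mul mul
      + coord mulForm bracketForm (r i) • cubicNode ℂ i mul bracket
      + coord bracketForm mulForm (r i) • cubicNode ℂ i bracket mul
      + coord bracketForm bracketForm (r i) • cubicNode ℂ i bracket bracket) := by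
  have h : r = ∑ i, Pi.single i (r i) := (Finset.univ_sum_single r).symm
  refine h.trans (Finset.sum_congr rfl fun i _ => ?_)
  conv_lhs => rw [tensor_eq (r i)]
  simp only [cubicNode, Pi.single_add, Pi.single_smul]

theorem mem_relations_iff (δ : ℂ) (r : CubicSpace ℂ (ℂ × ℂ)) :
    r ∈ relations δ ↔ Equations δ r := by
  constructor
  · intro hr
    refine Submodule.span_induction ?_ ?_ (fun _ _ _ _ => Equations.add)
      (fun c _ _ => Equations.smul c) hr
    · rintro _ ⟨σ, r, rfl | rfl | rfl, rfl⟩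
      · exact (equations_assoc δ).cubicRep σ
      · exact (equations_jacobi δ).cubicRep σ
      · exact (equations_leibniz δ).cubicRep σ
    · simpa using (equations_assoc δ).smul 0
  · intro hr
    -- The coefficients of `bracket ⊗ mul` are free and determine those of `mul ⊗ bracket`; the three
    -- coefficients of `mul ⊗ mul` add up to zero, so two rotations of associativity suffice.
    have h : r = ∑ i, coord bracketForm mulForm (r i) • (cubicNode ℂ i bracket mul
          - δ • (cubicNode ℂ (i + 1) mul bracket - cubicNode ℂ (i + 2) mul bracket))
        + coord bracketForm bracketForm (r 0) • jacobi
        + coord mulForm mulForm (r 2) • (cubicNode ℂ (0 + 2) mul mul - cubicNode ℂ 0 mul mul)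
        - coord mulForm mulForm (r 1) • (cubicNode ℂ (1 + 2) mul mul - cubicNode ℂ 1 mul mul) := by
      have hm := hr.mul_mul
      rw [Fin.sum_univ_three] at hm
      have hm : coord mulForm mulForm (r 0) =
          -coord mulForm mulForm (r 1) - coord mulForm mulForm (r 2) := by
        linear_combination hm
      have h₁₁ : (1 + 1 : Fin 3) = 2 := rfl
      have h₁₂ : (1 + 2 : Fin 3) = 0 := rfl
      have h₂₁ : (2 + 1 : Fin 3) = 0 := rfl
      have h₂₂ : (2 + 2 : Fin 3) = 1 := rfl
      conv_lhs => rw [cubic_eq r]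
      simp only [Fin.sum_univ_three, hr.mul_bracket, hr.bracket_bracket 1 0,
        hr.bracket_bracket 2 0, hm, jacobi, h₁₁, h₁₂, h₂₁, h₂₂, zero_add]
      module
    rw [h]
    exact sub_mem (add_mem (add_mem
      (sum_mem fun i _ => Submodule.smul_mem _ _ (leibniz_rotate_mem δ i))
      (Submodule.smul_mem _ _ (jacobi_mem δ)))
      (Submodule.smul_mem _ _ (assoc_rotate_mem δ 0)))
      (Submodule.smul_mem _ _ (assoc_rotate_mem δ 1))

/-! ### The annihilator of the relations -/

/-- The isomorphism `E^∨ ≃ E` that exchanges the product and the bracket. -/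
noncomputable def swapDual : Module.Dual ℂ (ℂ × ℂ) ≃ₗ[ℂ] ℂ × ℂ where
  toFun f := (f bracket, f mul)
  map_add' _ _ := rfl
  map_smul' _ _ := rfl
  invFun x := x.2 • mulForm + x.1 • bracketForm
  left_inv f := by
    ext <;> simp [mul, bracket]
  right_inv x := by
    ext <;> simp [mul, bracket]

theorem swapDual_apply (f : Module.Dual ℂ (ℂ × ℂ)) : swapDual f = (f bracket, f mul) := rfl

theorem swapDual_equivariant (σ : Equiv.Perm (Fin 2)) (f : Module.Dual ℂ (ℂ × ℂ)) :
    swapDual (signDual gens σ f) = gens σ (swapDual f) := by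
  have h : Equiv.Perm.sign σ = 1 ∨ Equiv.Perm.sign σ = -1 := Int.units_eq_one_or _
  have hneg : f (0, -1) = -f (0, 1) := by rw [← map_neg, Prod.neg_mk, neg_zero]
  rcases h with h | h <;>
    simp [swapDual_apply, signDual, gens, h, mul, bracket, Module.Dual.transpose_apply, hneg]

/-- The evaluation pairing in coordinates. Since `swapDual` exchanges the generators, each coefficient
of `x` is paired with the coefficient of the opposite monomial. -/
theorem dualDistrib_eq (f : Module.Dual ℂ (ℂ × ℂ) ⊗[ℂ] Module.Dual ℂ (ℂ × ℂ))
    (x : (ℂ × ℂ) ⊗[ℂ] (ℂ × ℂ)) :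
    TensorProduct.dualDistrib ℂ (ℂ × ℂ) (ℂ × ℂ) f x =
      coord bracketForm bracketForm (TensorProduct.map swapDual.toLinearMap swapDual.toLinearMap f)
          * coord mulForm mulForm x
        + coord bracketForm mulForm (TensorProduct.map swapDual.toLinearMap swapDual.toLinearMap f)
          * coord mulForm bracketForm x
        + coord mulForm bracketForm (TensorProduct.map swapDual.toLinearMap swapDual.toLinearMap f)
          * coord bracketForm mulForm x
        + coord mulForm mulForm (TensorProduct.map swapDual.toLinearMap swapDual.toLinearMap f)
          * coord bracketForm bracketForm x := by
  induction f with
  | zero => simp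
  | add f g hf hg =>
    simp only [map_add, LinearMap.add_apply, hf, hg]
    ring
  | tmul f g =>
    conv_lhs => rw [tensor_eq x]
    simp only [map_add, map_smul, smul_eq_mul, TensorProduct.dualDistrib_apply,
      TensorProduct.map_tmul, coord_tmul, LinearEquiv.coe_coe, swapDual_apply,
      LinearMap.fst_apply, LinearMap.snd_apply]
    ring

theorem cubicPairing_apply (f : CubicSpace ℂ (Module.Dual ℂ (ℂ × ℂ)))
    (r : CubicSpace ℂ (ℂ × ℂ)) :
    cubicPairing f r = ∑ i, TensorProduct.dualDistrib ℂ (ℂ × ℂ) (ℂ × ℂ) (f i) (r i) := by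
  simp [cubicPairing]

theorem cubicPairing_cubicNode (f : CubicSpace ℂ (Module.Dual ℂ (ℂ × ℂ))) (i : Fin 3)
    (μ ν : ℂ × ℂ) :
    cubicPairing f (cubicNode ℂ i μ ν) =
      TensorProduct.dualDistrib ℂ (ℂ × ℂ) (ℂ × ℂ) (f i) (μ ⊗ₜ ν) := by
  rw [cubicPairing_apply, Finset.sum_eq_single i]
  · simp [cubicNode]
  · intro j _ h
    simp [cubicNode, h]
  · simp

theorem mem_dual_relations_iff (δ : ℂ) (f : CubicSpace ℂ (Module.Dual ℂ (ℂ × ℂ))) :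
    (∀ r ∈ relations δ, cubicPairing f r = 0) ↔ Equations δ (cubicMap swapDual.toLinearMap f) := by
  constructor
  · intro hf
    -- Pairing with the Jacobi identity, the Leibniz rule and associativity gives the equations for
    -- `mul ⊗ mul`, `mul ⊗ bracket` and `bracket ⊗ bracket`, respectively.
    have hj := hf _ (jacobi_mem δ)
    have hl := fun i => hf _ (leibniz_rotate_mem δ i)
    have ha := fun i => hf _ (assoc_rotate_mem δ i)
    simp only [jacobi, map_add, map_sub, map_smul, cubicPairing_cubicNode, dualDistrib_eq,
      coord_tmul, mul, bracket, LinearMap.fst_apply, LinearMap.snd_apply, mul_zero, mul_one,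
      zero_add, add_zero, smul_eq_mul] at hj hl ha
    refine ⟨?_, fun i => ?_, fun i j => ?_⟩
    · simp only [Fin.sum_univ_three, cubicMap_apply]
      linear_combination hj
    · simp only [cubicMap_apply]
      linear_combination hl i
    · have h₀ := ha 0
      have h₁ := ha 1
      rw [zero_add] at h₀
      rw [show (1 + 2 : Fin 3) = 0 from rfl] at h₁
      simp only [cubicMap_apply]
      fin_cases i <;> fin_cases j <;>
        simp only [Fin.zero_eta, Fin.mk_one, Fin.reduceFinMk] <;>
        first
        | ring
        | linear_combination h₀
        | linear_combination h₁
        | linear_combination -h₀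
        | linear_combination -h₁
        | linear_combination h₀ + h₁
        | linear_combination -h₀ - h₁
  · intro hf r hr
    have hr := (mem_relations_iff δ r).1 hr
    have hm := hr.mul_mul
    have hm' := hf.mul_mul
    have h₁₁ : (1 + 1 : Fin 3) = 2 := rfl
    have h₁₂ : (1 + 2 : Fin 3) = 0 := rfl
    have h₂₁ : (2 + 1 : Fin 3) = 0 := rfl
    have h₂₂ : (2 + 2 : Fin 3) = 1 := rfl
    rw [Fin.sum_univ_three] at hm hm'
    simp only [cubicPairing_apply, dualDistrib_eq, ← cubicMap_apply, Fin.sum_univ_three,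
      hr.mul_bracket, hf.mul_bracket, hr.bracket_bracket 1 0, hr.bracket_bracket 2 0,
      hf.bracket_bracket 1 0, hf.bracket_bracket 2 0, h₁₁, h₁₂, h₂₁, h₂₂, zero_add]
    -- The mixed terms cancel because `(x, y) ↦ ∑ xᵢ (yᵢ₊₁ - yᵢ₊₂)` is antisymmetric.
    linear_combination coord bracketForm bracketForm (cubicMap swapDual.toLinearMap f 0) * hm
      + coord bracketForm bracketForm (r 0) * hm'

end DeltaPoisson

theorem mainTheorem9 (δ : ℂ) :
    Nonempty ((deltaPoissonDualOperad δ).Iso (deltaPoissonOperad δ)) := by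
  refine ⟨QuadraticData.operadIso (D := (DeltaPoisson.data δ).koszulDual)
    (D' := DeltaPoisson.data δ) DeltaPoisson.swapDual DeltaPoisson.swapDual_equivariant fun f => ?_⟩
  exact (DeltaPoisson.mem_dual_relations_iff δ f).trans
    (DeltaPoisson.mem_relations_iff δ _).symm
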